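/- Let $q$ be a prime power and let $\mathbb{F}_q$ be the finite field with $q$ elements. A full flag in $\mathbb{F}_q^v$ is a sequence $\Lambda=(W_1,\dots,W_{v-1})$ of subspaces $W_1<W_2<\dots<W_{v-1}$ of $\mathbb{F}_q^v$ with $\dim W_i=i$ for $1\le i\le v-1$. The Grassmann distance of two full flags $\Lambda=(W_1,\dots,W_{v-1})$ and $\Lambda'=(W_1',\dots,W_{v-1}')$ is $$\mathrm{d}_{\mathrm{G}}(\Lambda,\Lambda')=\sum_{i=1}^{v-1}\bigl(i-\dim(W_i\cap W_i')\bigr).$$ Let $A_q^f(v,d)$ denote the maximum cardinality of a set $\mathcal{C}$ of full flags in $\mathbb{F}_q^v$ such that $\mathrm{d}_{\mathrm{G}}(\Lambda,\Lambda')\ge d$ for all distinct $\Lambda,\Lambda'\in\mathcal{C}$. For integers $1\le k\le v$ write $$\binom{v}{k}_q=\prod_{i=1}^{k}\frac{q^{v-k+i}-1}{q^i-1}.$$ Then the following bounds and identities hold: $$A_q^f(5,2)\le\binom{5}{1}_q\binom{4}{1}_q\binom{3}{1}_q=q^9+3q^8+6q^7+9q^6+11q^5+11q^4+9q^3+6q^2+3q+1,$$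 $$A_q^f(5,3)\le\binom{5}{1}_q\binom{4}{1}_q=q^7+2q^6+3q^5+4q^4+4q^3+3q^2+2q+1,$$ $$A_q^f(5,4)\le\binom{5}{1}_q\,(q^2+1)=q^6+q^5+2q^4+2q^3+2q^2+q+1,$$ $$A_q^f(5,5)\le\binom{5}{1}_q=q^4+q^3+q^2+q+1,$$ $$A_q^f(6,6)\le\binom{6}{2}_q=q^8+q^7+2q^6+2q^5+3q^4+2q^3+2q^2+q+1,$$ $$A_q^f(6,7)\le\binom{6}{1}_q=q^5+q^4+q^3+q^2+q+1,$$ $$A_q^f(6,8)\le\binom{6}{1}_q\Big/\binom{2}{1}_q=q^4+q^2+1.$$ -/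

import Mathlib

namespace FlagCode

/-- The Gaussian binomial coefficient `∏_{i=1}^{k} (q^{v-k+i} - 1) / (q^i - 1)`, as a rational
number. The exponent is written `v + i - k`, which is `v - k + i` for `k ≤ v`; for `k > v` the
truncated exponent makes a factor, hence the product, equal to `0`. -/
def gaussBinom (v k q : ℕ) : ℚ :=
  ∏ i ∈ Finset.Icc 1 k, ((q : ℚ) ^ (v + i - k) - 1) / ((q : ℚ) ^ i - 1)

/-- The injection distance `max {dim U, dim W} - dim (U ∩ W)` of two subspaces of `F ^ v`. The
subtraction never truncates, as `dim (U ∩ W) ≤ dim U`. -/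
noncomputable def injDist {F : Type*} [Field F] {v : ℕ} (U W : Submodule F (Fin v → F)) : ℕ :=
  max (Module.finrank F U) (Module.finrank F W) - Module.finrank F (U ⊓ W : Submodule F (Fin v → F))

/-- A full flag `W_1 < W_2 < ... < W_{v-1}` in `F ^ v` with `dim W_j = j`; the subspace with index
`i : Fin (v - 1)` is `W_{i+1}`. -/
@[ext]
structure FullFlag (F : Type*) [Field F] (v : ℕ) where
  /-- The subspaces of the flag. -/
  space : Fin (v - 1) → Submodule F (Fin v → F)
  strictMono : StrictMono space
  finrank_space : ∀ i, Module.finrank F (space i) = (i : ℕ) + 1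

/-- The Grassmann distance of two full flags: the sum of the injection distances of their
components. -/
noncomputable def grassmannDist {F : Type*} [Field F] {v : ℕ} (Λ Λ' : FullFlag F v) : ℕ :=
  ∑ i, injDist (Λ.space i) (Λ'.space i)

/-- The minimum Grassmann distance of the full flag code `C` is at least `d`. -/
def HasMinDist {F : Type*} [Field F] {v : ℕ} (C : Finset (FullFlag F v)) (d : ℕ) : Prop :=
  ∀ Λ ∈ C, ∀ Λ' ∈ C, Λ ≠ Λ' → d ≤ grassmannDist Λ Λ'

/-- The maximum possible cardinality of a full flag code in `F ^ v` with minimum Grassmann distance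
at least `d`. For a field with `q` elements this is `A_q^f(v,d)`. -/
noncomputable def maxCode (F : Type*) [Field F] (v d : ℕ) : ℕ :=
  sSup {n : ℕ | ∃ C : Finset (FullFlag F v), HasMinDist C d ∧ C.card = n}

instance FullFlag.finite (F : Type*) [Field F] [Finite F] (v : ℕ) : Finite (FullFlag F v) :=
  Finite.of_injective (fun Λ => Λ.space) fun _ _ h => FullFlag.ext h

/-- Over a finite field the maximum in the definition of `maxCode` is attained. -/
theorem isGreatest_maxCode (F : Type*) [Field F] [Finite F] (v d : ℕ) :
    IsGreatest {n : ℕ | ∃ C : Finset (FullFlag F v), HasMinDist C d ∧ C.card = n}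
      (maxCode F v d) := by
  have hb : BddAbove {n : ℕ | ∃ C : Finset (FullFlag F v), HasMinDist C d ∧ C.card = n} := by
    refine ⟨Nat.card (FullFlag F v), ?_⟩
    rintro n ⟨C, -, rfl⟩
    have := Fintype.ofFinite (FullFlag F v)
    rw [Nat.card_eq_fintype_card]
    exact Finset.card_le_univ C
  exact ⟨Nat.sSup_mem ⟨0, ∅, by simp [HasMinDist], rfl⟩ hb, fun n hn => le_csSup hb hn⟩

end FlagCode

/-! The component `W_i` adds at most `min i (v - i)` to the distance. If two flags share a
component, the overlap persists in all larger ones and lowers their contributions too. So once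
suitable components are prescribed, the remaining distance stays below `d` and at most one codeword
is left; the bound is then the number of choices for those components (`card_le_mul_of_fibers`).
Prescribed are `W_1, W_2, W_3` for `(v, d) = (5, 2)`, `W_1, W_2` for `(5, 3)`, `W_1` for `(5, 5)`
and `(6, 7)`, and `W_2` for `(6, 6)`. In two cases the distance instead forces a minimal
intersection. For `(5, 4)`, codewords with the same `W_1` have `W_3`'s meeting only in `W_1`; for
`(6, 8)`, all the `W_2`'s meet trivially. Disjointness outside the common part
(`card_mul_le_of_pairwise_inf_eq`) gives `(q^5 - q)/(q^3 - q)` and `(q^6 - 1)/(q^2 - 1)`. -/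

namespace FlagCode

/-! ### Counting subspaces of a finite vector space -/

section Counting

variable {F V : Type*} [Field F] [AddCommGroup V] [Module F V] [Finite V]

/-- Subspaces of dimension `m` that pairwise meet in exactly the `k`-dimensional subspace `U` have
disjoint complements of `U`. -/
theorem card_mul_le_of_pairwise_inf_eq (U : Submodule F V) (m : ℕ) (S : Finset (Submodule F V))
    (hU : ∀ W ∈ S, U ≤ W) (hm : ∀ W ∈ S, Module.finrank F W = m)
    (hS : ∀ W ∈ S, ∀ W' ∈ S, W ≠ W' → W ⊓ W' = U) :
    S.card * (Nat.card F ^ m - Nat.card F ^ Module.finrank F U) ≤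
      Nat.card F ^ Module.finrank F V - Nat.card F ^ Module.finrank F U := by
  classical
  have := Fintype.ofFinite V
  have hcard (W : Submodule F V) :
      (Finset.univ.filter (· ∈ W)).card = Nat.card F ^ Module.finrank F W := by
    rw [← Module.natCard_eq_pow_finrank, ← Fintype.card_subtype, ← Nat.card_eq_fintype_card]
  have hdisj : (S : Set (Submodule F V)).PairwiseDisjoint
      (fun W => Finset.univ.filter (· ∈ W) \ Finset.univ.filter (· ∈ U)) := by
    intro W hW W' hW' hne
    rw [Function.onFun, Finset.disjoint_left]
    intro x hx hx'
    simp only [Finset.mem_sdiff, Finset.mem_filter, Finset.mem_univ, true_and] at hx hx'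
    exact hx.2 (hS W hW W' hW' hne ▸ ⟨hx.1, hx'.1⟩)
  calc S.card * (Nat.card F ^ m - Nat.card F ^ Module.finrank F U)
      = (S.biUnion fun W =>
          Finset.univ.filter (· ∈ W) \ Finset.univ.filter (· ∈ U)).card := by
        rw [Finset.card_biUnion hdisj, Finset.sum_const_nat]
        intro W hW
        rw [Finset.card_sdiff_of_subset, hcard, hcard, hm W hW]
        exact Finset.monotone_filter_right _ fun x _ hx => hU W hW hx
    _ ≤ (Finset.univ \ Finset.univ.filter (· ∈ U)).card := by
        refine Finset.card_le_card fun x hx => ?_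
        obtain ⟨W, -, hx⟩ := Finset.mem_biUnion.1 hx
        exact Finset.sdiff_subset_sdiff (Finset.subset_univ _) subset_rfl hx
    _ = _ := by
        rw [Finset.card_sdiff_of_subset (Finset.subset_univ _), hcard, Finset.card_univ,
          ← Nat.card_eq_fintype_card, Module.natCard_eq_pow_finrank (K := F)]

/-- Counting ordered bases: the number of subspaces of dimension `k` is at most the number of
linearly independent `k`-tuples divided by the number of bases of a `k`-dimensional space. -/
theorem card_mul_prod_le [Finite F] (k : ℕ) (S : Finset (Submodule F V)) (hk : k ≤ Module.finrank F V)
    (hS : ∀ W ∈ S, Module.finrank F W = k) :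
    S.card * ∏ i : Fin k, (Nat.card F ^ k - Nat.card F ^ (i : ℕ)) ≤
      ∏ i : Fin k, (Nat.card F ^ Module.finrank F V - Nat.card F ^ (i : ℕ)) := by
  classical
  have := Fintype.ofFinite F
  have hW (W : S) : Nat.card {s : Fin k → W.1 // LinearIndependent F s} =
      ∏ i : Fin k, (Nat.card F ^ k - Nat.card F ^ (i : ℕ)) := by
    have h := card_linearIndependent (K := F) (V := W.1) (k := k) (hS W W.2).ge
    rw [hS W W.2] at h
    simpa only [Nat.card_eq_fintype_card] using h
  have hV := card_linearIndependent (K := F) (V := V) hk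
  rw [← Nat.card_eq_fintype_card] at hV
  let f : (Σ W : S, {s : Fin k → W.1 // LinearIndependent F s}) →
      {s : Fin k → V // LinearIndependent F s} := fun p =>
    ⟨fun i => p.2.1 i, p.2.2.map' (Submodule.subtype _) (Submodule.ker_subtype _)⟩
  -- The span of a basis recovers its subspace, so a tuple in `V` comes from only one `W`.
  have hspan (p : Σ W : S, {s : Fin k → W.1 // LinearIndependent F s}) :
      Submodule.span F (Set.range (f p).1) = p.1.1 := by
    refine Submodule.eq_of_le_of_finrank_eq (Submodule.span_le.2 ?_) ?_
    · rintro _ ⟨i, rfl⟩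
      exact (p.2.1 i).2
    · rw [finrank_span_eq_card (f p).2, Fintype.card_fin, hS p.1 p.1.2]
  have hf : Function.Injective f := by
    rintro ⟨W, s⟩ ⟨W', s'⟩ h
    have hWW : W = W' := Subtype.ext <| by rw [← hspan ⟨W, s⟩, ← hspan ⟨W', s'⟩, h]
    subst hWW
    congr 1
    ext i
    exact congrFun (congrArg Subtype.val h) i
  have := Nat.card_le_card_of_injective f hf
  rwa [Nat.card_sigma, Finset.sum_congr rfl fun W _ => hW W, Finset.sum_const, Finset.card_univ,
    Fintype.card_coe, smul_eq_mul, hV] at this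

/-- Two subspaces of dimension `k + 1` containing a common `k`-dimensional subspace `U` meet in
`U`. -/
theorem inf_eq_of_finrank_eq_add_one {U W W' : Submodule F V} (hU : U ≤ W) (hU' : U ≤ W')
    (hW : Module.finrank F W = Module.finrank F U + 1)
    (hW' : Module.finrank F W' = Module.finrank F U + 1) (hne : W ≠ W') : W ⊓ W' = U := by
  refine (Submodule.eq_of_le_of_finrank_le (le_inf hU hU') ?_).symm
  -- A larger intersection would have full dimension in both spaces, hence equal both.
  by_contra! h
  have h1 : W ⊓ W' = W := Submodule.eq_of_le_of_finrank_le inf_le_left (by omega)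
  have h2 : W ⊓ W' = W' := Submodule.eq_of_le_of_finrank_le inf_le_right (by omega)
  exact hne (h1.symm.trans h2)

end Counting

/-! ### Intersection dimensions and fibres of flag codes -/

section Flags

variable {F : Type*} [Field F] {v : ℕ}

/-- Subtraction-free form of the distance, suited to `omega`. -/
theorem injDist_space_add (Λ Λ' : FullFlag F v) (i : Fin (v - 1)) :
    injDist (Λ.space i) (Λ'.space i) +
      Module.finrank F (Λ.space i ⊓ Λ'.space i : Submodule F (Fin v → F)) = i + 1 := by
  have h := Submodule.finrank_mono (inf_le_left : Λ.space i ⊓ Λ'.space i ≤ Λ.space i)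
  rw [Λ.finrank_space] at h
  rw [injDist, Λ.finrank_space, Λ'.finrank_space, max_self]
  omega

/-- The sum of the two components has dimension at most `v`; this caps the contribution of `W_j` at
`v - j`. -/
theorem two_mul_le_finrank_inf_add (Λ Λ' : FullFlag F v) (i : Fin (v - 1)) :
    2 * ((i : ℕ) + 1) ≤
      Module.finrank F (Λ.space i ⊓ Λ'.space i : Submodule F (Fin v → F)) + v := by
  have h := Submodule.finrank_sup_add_finrank_inf_eq (Λ.space i) (Λ'.space i)
  have h' := Submodule.finrank_le (Λ.space i ⊔ Λ'.space i)
  rw [Λ.finrank_space, Λ'.finrank_space] at h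
  rw [Module.finrank_fin_fun] at h'
  omega

theorem finrank_inf_mono (Λ Λ' : FullFlag F v) {i j : Fin (v - 1)} (hij : i ≤ j) :
    Module.finrank F (Λ.space i ⊓ Λ'.space i : Submodule F (Fin v → F)) ≤
      Module.finrank F (Λ.space j ⊓ Λ'.space j : Submodule F (Fin v → F)) :=
  Submodule.finrank_mono
    (inf_le_inf (Λ.strictMono.monotone hij) (Λ'.strictMono.monotone hij))

theorem finrank_inf_of_space_eq {Λ Λ' : FullFlag F v} {i : Fin (v - 1)}
    (h : Λ.space i = Λ'.space i) :
    Module.finrank F (Λ.space i ⊓ Λ'.space i : Submodule F (Fin v → F)) = i + 1 := by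
  rw [h, inf_idem, Λ'.finrank_space]

open Classical in
/-- Fibering a code over the component `i`. -/
theorem card_le_mul_of_fibers (C : Finset (FullFlag F v)) (i : Fin (v - 1)) {M N : ℕ}
    (hM : (C.image fun Λ => Λ.space i).card ≤ M)
    (hN : ∀ D ⊆ C, ∀ U : Submodule F (Fin v → F), (∀ Λ ∈ D, Λ.space i = U) → D.card ≤ N) :
    C.card ≤ M * N := by
  refine (Finset.card_le_mul_card_image (f := fun Λ => Λ.space i) C N fun U _ =>
    hN _ (Finset.filter_subset _ _) U fun Λ hΛ => (Finset.mem_filter.1 hΛ).2).trans ?_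
  rw [mul_comm]
  exact Nat.mul_le_mul_right N hM

theorem grassmannDist_five (Λ Λ' : FullFlag F 5) : grassmannDist Λ Λ' =
    injDist (Λ.space (0 : Fin 4)) (Λ'.space (0 : Fin 4)) +
    injDist (Λ.space (1 : Fin 4)) (Λ'.space (1 : Fin 4)) +
    injDist (Λ.space (2 : Fin 4)) (Λ'.space (2 : Fin 4)) +
    injDist (Λ.space (3 : Fin 4)) (Λ'.space (3 : Fin 4)) :=
  Fin.sum_univ_four _

theorem grassmannDist_six (Λ Λ' : FullFlag F 6) : grassmannDist Λ Λ' =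
    injDist (Λ.space (0 : Fin 5)) (Λ'.space (0 : Fin 5)) +
    injDist (Λ.space (1 : Fin 5)) (Λ'.space (1 : Fin 5)) +
    injDist (Λ.space (2 : Fin 5)) (Λ'.space (2 : Fin 5)) +
    injDist (Λ.space (3 : Fin 5)) (Λ'.space (3 : Fin 5)) +
    injDist (Λ.space (4 : Fin 5)) (Λ'.space (4 : Fin 5)) :=
  Fin.sum_univ_five _

variable [Finite F]

theorem two_le_card : 2 ≤ Nat.card F := Finite.one_lt_card

theorem maxCode_le {d N : ℕ} (h : ∀ C : Finset (FullFlag F v), HasMinDist C d → C.card ≤ N) :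
    maxCode F v d ≤ N := by
  obtain ⟨C, hC, hN⟩ := (isGreatest_maxCode F v d).1
  exact hN ▸ h C hC

open Classical in
/-- Successive components, given the common component `i`. -/
theorem card_image_space_le_of_const (D : Finset (FullFlag F v)) {i j : Fin (v - 1)}
    (hij : (j : ℕ) = i + 1) (U : Submodule F (Fin v → F)) (hU : ∀ Λ ∈ D, Λ.space i = U)
    (N : ℕ) (hN : N * (Nat.card F ^ (j + 1 : ℕ) - Nat.card F ^ (i + 1 : ℕ)) =
      Nat.card F ^ v - Nat.card F ^ (i + 1 : ℕ)) :
    (D.image fun Λ => Λ.space j).card ≤ N := by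
  -- The dimension of `U` is known only through a member of `D`.
  obtain rfl | ⟨Λ₀, hΛ₀⟩ := D.eq_empty_or_nonempty
  · simp
  have hfU : Module.finrank F U = i + 1 := by rw [← hU Λ₀ hΛ₀, Λ₀.finrank_space]
  have hle : ∀ W ∈ D.image (fun Λ => Λ.space j), U ≤ W := by
    intro W hW
    obtain ⟨Λ, hΛ, rfl⟩ := Finset.mem_image.1 hW
    exact hU Λ hΛ ▸ Λ.strictMono.monotone (Fin.le_def.2 (by omega))
  have hrk : ∀ W : Submodule F (Fin v → F), W ∈ D.image (fun Λ => Λ.space j) →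
      Module.finrank F W = (j : ℕ) + 1 := by
    intro W hW
    obtain ⟨Λ, hΛ, rfl⟩ := Finset.mem_image.1 hW
    exact Λ.finrank_space j
  have h := card_mul_le_of_pairwise_inf_eq U (j + 1) (D.image fun Λ => Λ.space j) hle hrk
    fun W hW W' hW' hne => inf_eq_of_finrank_eq_add_one (hle W hW) (hle W' hW')
      (by rw [hrk W hW, hfU, hij]) (by rw [hrk W' hW', hfU, hij]) hne
  rw [hfU, Module.finrank_fin_fun, ← hN] at h
  refine Nat.le_of_mul_le_mul_right h (Nat.sub_pos_of_lt ?_)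
  exact Nat.pow_lt_pow_right two_le_card (by omega)

-- Partial spread bound: the nonzero vectors of the distinct components are disjoint sets.
open Classical in
theorem card_image_space_le_of_disjoint (C : Finset (FullFlag F v)) (i : Fin (v - 1))
    (h : ∀ Λ ∈ C, ∀ Λ' ∈ C, Λ.space i ≠ Λ'.space i → Λ.space i ⊓ Λ'.space i = ⊥)
    (N : ℕ) (hN : N * (Nat.card F ^ (i + 1 : ℕ) - 1) = Nat.card F ^ v - 1) :
    (C.image fun Λ => Λ.space i).card ≤ N := by
  have h := card_mul_le_of_pairwise_inf_eq ⊥ (i + 1) (C.image fun Λ => Λ.space i)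
    (fun _ _ => bot_le) (by
      intro W hW
      obtain ⟨Λ, hΛ, rfl⟩ := Finset.mem_image.1 hW
      exact Λ.finrank_space i) (by
      intro W hW W' hW' hne
      obtain ⟨Λ, hΛ, rfl⟩ := Finset.mem_image.1 hW
      obtain ⟨Λ', hΛ', rfl⟩ := Finset.mem_image.1 hW'
      exact h Λ hΛ Λ' hΛ' hne)
  rw [finrank_bot, pow_zero, Module.finrank_fin_fun, ← hN] at h
  refine Nat.le_of_mul_le_mul_right h (Nat.sub_pos_of_lt ?_)
  exact Nat.one_lt_pow (by omega) two_le_card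

open Classical in
theorem card_image_space_zero_le (C : Finset (FullFlag F v)) (i : Fin (v - 1)) (hi : (i : ℕ) = 0)
    (N : ℕ) (hN : N * (Nat.card F - 1) = Nat.card F ^ v - 1) :
    (C.image fun Λ => Λ.space i).card ≤ N := by
  refine card_image_space_le_of_disjoint C i (fun Λ _ Λ' _ hne => ?_) N (by simpa [hi] using hN)
  refine inf_eq_of_finrank_eq_add_one bot_le bot_le ?_ ?_ hne <;>
    rw [FullFlag.finrank_space, hi, finrank_bot]

/-- Reduces identities with truncated subtraction to polynomial ones that `ring` proves. -/
theorem mul_sub_eq_sub {N x y z : ℕ} (h : N * x + y = z + N * y) : N * (x - y) = z - y := by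
  rw [Nat.mul_sub]
  omega

/-! ### The seven bounds on code size -/

/-- The final factor `1`, here and below, bounds a fibre in which any two codewords coincide. Here
only `W_4` can differ, adding at most 1. -/
theorem maxCode_five_two_le : maxCode F 5 2 ≤
    (Nat.card F ^ 4 + Nat.card F ^ 3 + Nat.card F ^ 2 + Nat.card F + 1) *
      ((Nat.card F ^ 3 + Nat.card F ^ 2 + Nat.card F + 1) *
        ((Nat.card F ^ 2 + Nat.card F + 1) * 1)) := by
  refine maxCode_le fun C hC => card_le_mul_of_fibers C (0 : Fin 4)
    (card_image_space_zero_le C _ rfl _ (mul_sub_eq_sub (by ring))) fun D hD U hU =>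
    card_le_mul_of_fibers D (1 : Fin 4)
      (card_image_space_le_of_const D rfl U hU _ (mul_sub_eq_sub (by simp; ring)))
      fun E hE U' hU' => card_le_mul_of_fibers E (2 : Fin 4)
        (card_image_space_le_of_const E rfl U' hU' _ (mul_sub_eq_sub (by simp; ring)))
        fun G hG U'' hU'' => Finset.card_le_one.2 fun Λ hΛ Λ' hΛ' => ?_
  by_contra hne
  have hd := hC Λ (hD (hE (hG hΛ))) Λ' (hD (hE (hG hΛ'))) hne
  have e0 := finrank_inf_of_space_eq ((hU Λ (hE (hG hΛ))).trans (hU Λ' (hE (hG hΛ'))).symm)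
  have e1 := finrank_inf_of_space_eq ((hU' Λ (hG hΛ)).trans (hU' Λ' (hG hΛ')).symm)
  have e2 := finrank_inf_of_space_eq ((hU'' Λ hΛ).trans (hU'' Λ' hΛ').symm)
  have d0 := injDist_space_add Λ Λ' (0 : Fin 4)
  have d1 := injDist_space_add Λ Λ' (1 : Fin 4)
  have d2 := injDist_space_add Λ Λ' (2 : Fin 4)
  have d3 := injDist_space_add Λ Λ' (3 : Fin 4)
  have t3 := two_mul_le_finrank_inf_add Λ Λ' (3 : Fin 4)
  rw [grassmannDist_five] at hd
  simp at *
  omega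

theorem maxCode_five_three_le : maxCode F 5 3 ≤
    (Nat.card F ^ 4 + Nat.card F ^ 3 + Nat.card F ^ 2 + Nat.card F + 1) *
      ((Nat.card F ^ 3 + Nat.card F ^ 2 + Nat.card F + 1) * 1) := by
  refine maxCode_le fun C hC => card_le_mul_of_fibers C (0 : Fin 4)
    (card_image_space_zero_le C _ rfl _ (mul_sub_eq_sub (by ring))) fun D hD U hU =>
    card_le_mul_of_fibers D (1 : Fin 4)
      (card_image_space_le_of_const D rfl U hU _ (mul_sub_eq_sub (by simp; ring)))
      fun E hE U' hU' => Finset.card_le_one.2 fun Λ hΛ Λ' hΛ' => ?_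
  -- `W_3` and `W_4` add at most 1 each.
  by_contra hne
  have hd := hC Λ (hD (hE hΛ)) Λ' (hD (hE hΛ')) hne
  have e0 := finrank_inf_of_space_eq ((hU Λ (hE hΛ)).trans (hU Λ' (hE hΛ')).symm)
  have e1 := finrank_inf_of_space_eq ((hU' Λ hΛ).trans (hU' Λ' hΛ').symm)
  have d0 := injDist_space_add Λ Λ' (0 : Fin 4)
  have d1 := injDist_space_add Λ Λ' (1 : Fin 4)
  have d2 := injDist_space_add Λ Λ' (2 : Fin 4)
  have d3 := injDist_space_add Λ Λ' (3 : Fin 4)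
  have m2 := finrank_inf_mono Λ Λ' (i := (1 : Fin 4)) (j := (2 : Fin 4)) (by decide)
  have t3 := two_mul_le_finrank_inf_add Λ Λ' (3 : Fin 4)
  rw [grassmannDist_five] at hd
  simp at *
  omega

open Classical in
theorem maxCode_five_four_le : maxCode F 5 4 ≤
    (Nat.card F ^ 4 + Nat.card F ^ 3 + Nat.card F ^ 2 + Nat.card F + 1) *
      (Nat.card F ^ 2 + 1) := by
  refine maxCode_le fun C hC => card_le_mul_of_fibers C (0 : Fin 4)
    (card_image_space_zero_le C _ rfl _ (mul_sub_eq_sub (by ring))) fun D hD U hU => ?_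
  obtain rfl | ⟨Λ₀, hΛ₀⟩ := D.eq_empty_or_nonempty
  · simp
  have hfU : Module.finrank F U = 1 := by rw [← hU Λ₀ hΛ₀, Λ₀.finrank_space]; rfl
  have hle (Λ) (hΛ : Λ ∈ D) : U ≤ Λ.space (2 : Fin 4) :=
    hU Λ hΛ ▸ Λ.strictMono.monotone (by decide : (0 : Fin 4) ≤ 2)
  -- With `W_1` shared, `W_2` and `W_4` add at most 1 each, so `W_3` must add at least 2.
  have key (Λ) (hΛ : Λ ∈ D) (Λ') (hΛ' : Λ' ∈ D) (hne : Λ ≠ Λ') :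
      Module.finrank F
        (Λ.space (2 : Fin 4) ⊓ Λ'.space (2 : Fin 4) : Submodule F (Fin 5 → F)) ≤ 1 := by
    have hd := hC Λ (hD hΛ) Λ' (hD hΛ') hne
    have e0 := finrank_inf_of_space_eq ((hU Λ hΛ).trans (hU Λ' hΛ').symm)
    have d0 := injDist_space_add Λ Λ' (0 : Fin 4)
    have d1 := injDist_space_add Λ Λ' (1 : Fin 4)
    have d2 := injDist_space_add Λ Λ' (2 : Fin 4)
    have d3 := injDist_space_add Λ Λ' (3 : Fin 4)
    have m1 := finrank_inf_mono Λ Λ' (i := (0 : Fin 4)) (j := (1 : Fin 4)) (by decide)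
    have t3 := two_mul_le_finrank_inf_add Λ Λ' (3 : Fin 4)
    rw [grassmannDist_five] at hd
    simp at *
    omega
  have hinj : Set.InjOn (fun Λ : FullFlag F 5 => Λ.space (2 : Fin 4)) D := by
    intro Λ hΛ Λ' hΛ' h
    by_contra hne
    have := key Λ hΛ Λ' hΛ' hne
    rw [finrank_inf_of_space_eq h] at this
    exact absurd this (by decide)
  rw [← Finset.card_image_of_injOn hinj]
  have h := card_mul_le_of_pairwise_inf_eq U 3 (D.image fun Λ => Λ.space (2 : Fin 4))
    (by
      intro W hW
      obtain ⟨Λ, hΛ, rfl⟩ := Finset.mem_image.1 hW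
      exact hle Λ hΛ) (by
      intro W hW
      obtain ⟨Λ, hΛ, rfl⟩ := Finset.mem_image.1 hW
      exact Λ.finrank_space _) (by
      intro W hW W' hW' hne
      obtain ⟨Λ, hΛ, rfl⟩ := Finset.mem_image.1 hW
      obtain ⟨Λ', hΛ', rfl⟩ := Finset.mem_image.1 hW'
      refine (Submodule.eq_of_le_of_finrank_le (le_inf (hle Λ hΛ) (hle Λ' hΛ')) ?_).symm
      rw [hfU]
      exact key Λ hΛ Λ' hΛ' fun h => hne (h ▸ rfl))
  rw [hfU, Module.finrank_fin_fun,
    ← mul_sub_eq_sub (N := Nat.card F ^ 2 + 1) (x := Nat.card F ^ 3) (y := Nat.card F ^ 1)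
      (z := Nat.card F ^ 5) (by ring)] at h
  refine Nat.le_of_mul_le_mul_right h (Nat.sub_pos_of_lt ?_)
  exact Nat.pow_lt_pow_right two_le_card (by norm_num)

theorem maxCode_five_five_le : maxCode F 5 5 ≤
    (Nat.card F ^ 4 + Nat.card F ^ 3 + Nat.card F ^ 2 + Nat.card F + 1) * 1 := by
  refine maxCode_le fun C hC => card_le_mul_of_fibers C (0 : Fin 4)
    (card_image_space_zero_le C _ rfl _ (mul_sub_eq_sub (by ring))) fun D hD U hU =>
    Finset.card_le_one.2 fun Λ hΛ Λ' hΛ' => ?_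
  -- The contributions are at most 0, 1, 2, 1, in total 4.
  by_contra hne
  have hd := hC Λ (hD hΛ) Λ' (hD hΛ') hne
  have e0 := finrank_inf_of_space_eq ((hU Λ hΛ).trans (hU Λ' hΛ').symm)
  have d0 := injDist_space_add Λ Λ' (0 : Fin 4)
  have d1 := injDist_space_add Λ Λ' (1 : Fin 4)
  have d2 := injDist_space_add Λ Λ' (2 : Fin 4)
  have d3 := injDist_space_add Λ Λ' (3 : Fin 4)
  have m1 := finrank_inf_mono Λ Λ' (i := (0 : Fin 4)) (j := (1 : Fin 4)) (by decide)
  have m2 := finrank_inf_mono Λ Λ' (i := (0 : Fin 4)) (j := (2 : Fin 4)) (by decide)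
  have t3 := two_mul_le_finrank_inf_add Λ Λ' (3 : Fin 4)
  rw [grassmannDist_five] at hd
  simp at *
  omega

theorem maxCode_six_six_le : maxCode F 6 6 ≤
    (Nat.card F ^ 8 + Nat.card F ^ 7 + 2 * Nat.card F ^ 6 + 2 * Nat.card F ^ 5 +
      3 * Nat.card F ^ 4 + 2 * Nat.card F ^ 3 + 2 * Nat.card F ^ 2 + Nat.card F + 1) * 1 := by
  classical
  refine maxCode_le fun C hC => card_le_mul_of_fibers C (1 : Fin 5) ?_ fun D hD U hU =>
    Finset.card_le_one.2 fun Λ hΛ Λ' hΛ' => ?_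
  · have h := card_mul_prod_le 2 (C.image fun Λ => Λ.space (1 : Fin 5))
      (by rw [Module.finrank_fin_fun]; norm_num) (by
        intro W hW
        obtain ⟨Λ, hΛ, rfl⟩ := Finset.mem_image.1 hW
        exact Λ.finrank_space _)
    rw [Module.finrank_fin_fun, Fin.prod_univ_two, Fin.prod_univ_two] at h
    simp only [Fin.val_zero, Fin.val_one, pow_zero, pow_one] at h
    have h2 : 2 ≤ Nat.card F := two_le_card
    have hpos : 0 < (Nat.card F ^ 2 - 1) * (Nat.card F ^ 2 - Nat.card F) := by
      refine Nat.mul_pos (Nat.sub_pos_of_lt ?_) (Nat.sub_pos_of_lt ?_) <;> nlinarith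
    -- The claimed polynomial is `(q^6 - 1)(q^6 - q) / ((q^2 - 1)(q^2 - q))`.
    refine Nat.le_of_mul_le_mul_right (h.trans_eq ?_) hpos
    have h1 : 1 ≤ Nat.card F := by omega
    zify [Nat.one_le_pow _ _ h1, Nat.le_self_pow (n := 2) two_ne_zero (Nat.card F),
      Nat.le_self_pow (n := 6) (by norm_num) (Nat.card F)]
    ring
  -- The contributions are at most 1, 0, 1, 2, 1, in total 5.
  · by_contra hne
    have hd := hC Λ (hD hΛ) Λ' (hD hΛ') hne
    have e1 := finrank_inf_of_space_eq ((hU Λ hΛ).trans (hU Λ' hΛ').symm)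
    have d0 := injDist_space_add Λ Λ' (0 : Fin 5)
    have d1 := injDist_space_add Λ Λ' (1 : Fin 5)
    have d2 := injDist_space_add Λ Λ' (2 : Fin 5)
    have d3 := injDist_space_add Λ Λ' (3 : Fin 5)
    have d4 := injDist_space_add Λ Λ' (4 : Fin 5)
    have m2 := finrank_inf_mono Λ Λ' (i := (1 : Fin 5)) (j := (2 : Fin 5)) (by decide)
    have t3 := two_mul_le_finrank_inf_add Λ Λ' (3 : Fin 5)
    have t4 := two_mul_le_finrank_inf_add Λ Λ' (4 : Fin 5)
    rw [grassmannDist_six] at hd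
    simp at *
    omega

theorem maxCode_six_seven_le : maxCode F 6 7 ≤
    (Nat.card F ^ 5 + Nat.card F ^ 4 + Nat.card F ^ 3 + Nat.card F ^ 2 + Nat.card F + 1) * 1 := by
  refine maxCode_le fun C hC => card_le_mul_of_fibers C (0 : Fin 5)
    (card_image_space_zero_le C _ rfl _ (mul_sub_eq_sub (by ring))) fun D hD U hU =>
    Finset.card_le_one.2 fun Λ hΛ Λ' hΛ' => ?_
  -- The contributions are at most 0, 1, 2, 2, 1, in total 6.
  by_contra hne
  have hd := hC Λ (hD hΛ) Λ' (hD hΛ') hne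
  have e0 := finrank_inf_of_space_eq ((hU Λ hΛ).trans (hU Λ' hΛ').symm)
  have d0 := injDist_space_add Λ Λ' (0 : Fin 5)
  have d1 := injDist_space_add Λ Λ' (1 : Fin 5)
  have d2 := injDist_space_add Λ Λ' (2 : Fin 5)
  have d3 := injDist_space_add Λ Λ' (3 : Fin 5)
  have d4 := injDist_space_add Λ Λ' (4 : Fin 5)
  have m1 := finrank_inf_mono Λ Λ' (i := (0 : Fin 5)) (j := (1 : Fin 5)) (by decide)
  have m2 := finrank_inf_mono Λ Λ' (i := (0 : Fin 5)) (j := (2 : Fin 5)) (by decide)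
  have t3 := two_mul_le_finrank_inf_add Λ Λ' (3 : Fin 5)
  have t4 := two_mul_le_finrank_inf_add Λ Λ' (4 : Fin 5)
  rw [grassmannDist_six] at hd
  simp at *
  omega

theorem maxCode_six_eight_le : maxCode F 6 8 ≤ (Nat.card F ^ 4 + Nat.card F ^ 2 + 1) * 1 := by
  refine maxCode_le fun C hC => ?_
  -- If the `W_2`'s met nontrivially, so would the `W_3`'s, leaving at most 1 + 1 + 2 + 2 + 1 = 7.
  have key (Λ) (hΛ : Λ ∈ C) (Λ') (hΛ' : Λ' ∈ C) (hne : Λ ≠ Λ') :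
      Module.finrank F
        (Λ.space (1 : Fin 5) ⊓ Λ'.space (1 : Fin 5) : Submodule F (Fin 6 → F)) = 0 := by
    have hd := hC Λ hΛ Λ' hΛ' hne
    have d0 := injDist_space_add Λ Λ' (0 : Fin 5)
    have d1 := injDist_space_add Λ Λ' (1 : Fin 5)
    have d2 := injDist_space_add Λ Λ' (2 : Fin 5)
    have d3 := injDist_space_add Λ Λ' (3 : Fin 5)
    have d4 := injDist_space_add Λ Λ' (4 : Fin 5)
    have m2 := finrank_inf_mono Λ Λ' (i := (1 : Fin 5)) (j := (2 : Fin 5)) (by decide)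
    have t3 := two_mul_le_finrank_inf_add Λ Λ' (3 : Fin 5)
    have t4 := two_mul_le_finrank_inf_add Λ Λ' (4 : Fin 5)
    rw [grassmannDist_six] at hd
    simp at hd d0 d1 d2 d3 d4 m2 t3 t4
    omega
  refine card_le_mul_of_fibers C (1 : Fin 5)
    (card_image_space_le_of_disjoint C _ (fun Λ hΛ Λ' hΛ' hne => ?_) _
      (mul_sub_eq_sub (by simp; ring))) fun D hD U hU =>
    Finset.card_le_one.2 fun Λ hΛ Λ' hΛ' => ?_
  · exact Submodule.finrank_eq_zero.1 (key Λ hΛ Λ' hΛ' fun h => hne (h ▸ rfl))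
  · by_contra hne
    have := key Λ (hD hΛ) Λ' (hD hΛ') hne
    rw [finrank_inf_of_space_eq ((hU Λ hΛ).trans (hU Λ' hΛ').symm)] at this
    exact Nat.succ_ne_zero _ this

end Flags

/-! ### Gaussian binomials as polynomials in `q` -/

section GaussBinom

theorem gaussBinom_one {v q : ℕ} (hq : 2 ≤ q) :
    gaussBinom v 1 q = ∑ i ∈ Finset.range v, (q : ℚ) ^ i := by
  have h : (q : ℚ) ≠ 1 := by
    norm_cast
    omega
  rw [geom_sum_eq h]
  simp [gaussBinom]

theorem gaussBinom_six_two {q : ℕ} (hq : 2 ≤ q) : gaussBinom 6 2 q =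
    (q : ℚ) ^ 8 + (q : ℚ) ^ 7 + 2 * (q : ℚ) ^ 6 + 2 * (q : ℚ) ^ 5 + 3 * (q : ℚ) ^ 4
      + 2 * (q : ℚ) ^ 3 + 2 * (q : ℚ) ^ 2 + (q : ℚ) + 1 := by
  have hq' : (2 : ℚ) ≤ q := mod_cast hq
  have h1 : (q : ℚ) - 1 ≠ 0 := by linarith
  have h2 : (q : ℚ) ^ 2 - 1 ≠ 0 := by nlinarith
  rw [gaussBinom, Finset.prod_Icc_succ_top (by norm_num), Finset.Icc_self, Finset.prod_singleton]
  norm_num only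
  rw [pow_one]
  field_simp
  ring

end GaussBinom

end FlagCode

theorem mainTheorem11 (q : ℕ) (F : Type*) [Field F] [Finite F] (hq : Nat.card F = q) :
    ((FlagCode.maxCode F 5 2 : ℚ) ≤
        FlagCode.gaussBinom 5 1 q * FlagCode.gaussBinom 4 1 q * FlagCode.gaussBinom 3 1 q ∧
      FlagCode.gaussBinom 5 1 q * FlagCode.gaussBinom 4 1 q * FlagCode.gaussBinom 3 1 q =
        (q : ℚ) ^ 9 + 3 * (q : ℚ) ^ 8 + 6 * (q : ℚ) ^ 7 + 9 * (q : ℚ) ^ 6 + 11 * (q : ℚ) ^ 5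
          + 11 * (q : ℚ) ^ 4 + 9 * (q : ℚ) ^ 3 + 6 * (q : ℚ) ^ 2 + 3 * (q : ℚ) + 1) ∧
    ((FlagCode.maxCode F 5 3 : ℚ) ≤ FlagCode.gaussBinom 5 1 q * FlagCode.gaussBinom 4 1 q ∧
      FlagCode.gaussBinom 5 1 q * FlagCode.gaussBinom 4 1 q =
        (q : ℚ) ^ 7 + 2 * (q : ℚ) ^ 6 + 3 * (q : ℚ) ^ 5 + 4 * (q : ℚ) ^ 4 + 4 * (q : ℚ) ^ 3
          + 3 * (q : ℚ) ^ 2 + 2 * (q : ℚ) + 1) ∧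
    ((FlagCode.maxCode F 5 4 : ℚ) ≤ FlagCode.gaussBinom 5 1 q * ((q : ℚ) ^ 2 + 1) ∧
      FlagCode.gaussBinom 5 1 q * ((q : ℚ) ^ 2 + 1) =
        (q : ℚ) ^ 6 + (q : ℚ) ^ 5 + 2 * (q : ℚ) ^ 4 + 2 * (q : ℚ) ^ 3 + 2 * (q : ℚ) ^ 2
          + (q : ℚ) + 1) ∧
    ((FlagCode.maxCode F 5 5 : ℚ) ≤ FlagCode.gaussBinom 5 1 q ∧
      FlagCode.gaussBinom 5 1 q =
        (q : ℚ) ^ 4 + (q : ℚ) ^ 3 + (q : ℚ) ^ 2 + (q : ℚ) + 1) ∧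
    ((FlagCode.maxCode F 6 6 : ℚ) ≤ FlagCode.gaussBinom 6 2 q ∧
      FlagCode.gaussBinom 6 2 q =
        (q : ℚ) ^ 8 + (q : ℚ) ^ 7 + 2 * (q : ℚ) ^ 6 + 2 * (q : ℚ) ^ 5 + 3 * (q : ℚ) ^ 4
          + 2 * (q : ℚ) ^ 3 + 2 * (q : ℚ) ^ 2 + (q : ℚ) + 1) ∧
    ((FlagCode.maxCode F 6 7 : ℚ) ≤ FlagCode.gaussBinom 6 1 q ∧
      FlagCode.gaussBinom 6 1 q =
        (q : ℚ) ^ 5 + (q : ℚ) ^ 4 + (q : ℚ) ^ 3 + (q : ℚ) ^ 2 + (q : ℚ) + 1) ∧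
    ((FlagCode.maxCode F 6 8 : ℚ) ≤ FlagCode.gaussBinom 6 1 q / FlagCode.gaussBinom 2 1 q ∧
      FlagCode.gaussBinom 6 1 q / FlagCode.gaussBinom 2 1 q =
        (q : ℚ) ^ 4 + (q : ℚ) ^ 2 + 1) := by
  subst hq
  have hq : 2 ≤ Nat.card F := FlagCode.two_le_card
  have hsum : (Nat.card F : ℚ) + 1 ≠ 0 := by positivity
  have hquot : (FlagCode.gaussBinom 6 1 (Nat.card F) / FlagCode.gaussBinom 2 1 (Nat.card F) : ℚ) =
      (Nat.card F : ℚ) ^ 4 + (Nat.card F : ℚ) ^ 2 + 1 := by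
    simp only [FlagCode.gaussBinom_one hq, Finset.sum_range_succ, Finset.sum_range_zero]
    rw [div_eq_iff (by simpa [add_comm] using hsum)]
    ring
  have h2 := Nat.cast_le (α := ℚ).2 (FlagCode.maxCode_five_two_le (F := F))
  have h3 := Nat.cast_le (α := ℚ).2 (FlagCode.maxCode_five_three_le (F := F))
  have h4 := Nat.cast_le (α := ℚ).2 (FlagCode.maxCode_five_four_le (F := F))
  have h5 := Nat.cast_le (α := ℚ).2 (FlagCode.maxCode_five_five_le (F := F))
  have h6 := Nat.cast_le (α := ℚ).2 (FlagCode.maxCode_six_six_le (F := F))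
  have h7 := Nat.cast_le (α := ℚ).2 (FlagCode.maxCode_six_seven_le (F := F))
  have h8 := Nat.cast_le (α := ℚ).2 (FlagCode.maxCode_six_eight_le (F := F))
  push_cast at h2 h3 h4 h5 h6 h7 h8
  rw [hquot, FlagCode.gaussBinom_six_two hq]
  simp only [FlagCode.gaussBinom_one hq, Finset.sum_range_succ, Finset.sum_range_zero]
  refine ⟨⟨h2.trans_eq ?_, ?_⟩, ⟨h3.trans_eq ?_, ?_⟩, ⟨h4.trans_eq ?_, ?_⟩, ⟨h5.trans_eq ?_, ?_⟩,
    ⟨h6.trans_eq ?_, trivial⟩, ⟨h7.trans_eq ?_, ?_⟩, ⟨h8.trans_eq ?_, trivial⟩⟩ <;> ring
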